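/- Let $n\ge 1$ and let $\mathbb H$ denote Hamilton's quaternions. Let $\mathrm{Sp}(n,1)$ be the group of invertible matrices $A\in M_{n+1}(\mathbb H)$ preserving the Hermitian form of signature $(n,1)$ $$\langle z,w\rangle=\bar w_{n+1}z_1+\sum_{i=2}^{n}\bar w_i z_i+\bar w_1 z_{n+1}$$ on the right vector space $\mathbb H^{n+1}$, and let $\mathrm{PSp}(n,1)=\mathrm{Sp}(n,1)/\{\pm I\}$, with its usual Lie group topology. A pair $(g_1,g_2)$ of elements of a group $G$ is called strongly doubly reversible if there is $h\in G$ with $h^2=1$ and $hg_ih^{-1}=g_i^{-1}$ for $i=1,2$. Then the set of strongly doubly reversible pairs in $\mathrm{PSp}(n,1)\times \mathrm{PSp}(n,1)$ has Haar measure zero, i.e. it is a null set for every Haar measure on the group $\mathrm{PSp}(n,1)\times \mathrm{PSp}(n,1)$. -/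

import Mathlib

open scoped Quaternion Matrix

namespace QuatHyp

/-- The `(n+1) × (n+1)` matrix of the Hermitian form on `ℍ^{n,1}`: it exchanges the first and the
last coordinate and is the identity on the `n - 1` middle ones (signature `(n,1)` for `n ≥ 1`). -/
noncomputable def formMatrix (n : ℕ) : Matrix (Fin (n + 1)) (Fin (n + 1)) ℍ[ℝ] :=
  fun i j => if Equiv.swap 0 (Fin.last n) i = j then 1 else 0

/-- The Hermitian form `⟨z, w⟩ = w^* H z` on the right `ℍ`-vector space `ℍ^{n+1}`. -/
noncomputable def hermForm (n : ℕ) (z w : Fin (n + 1) → ℍ[ℝ]) : ℍ[ℝ] :=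
  star w ⬝ᵥ (formMatrix n *ᵥ z)

/-- `Sp(n,1)`: the invertible quaternionic matrices that preserve the Hermitian form. -/
def Sp (n : ℕ) : Subgroup (Matrix (Fin (n + 1)) (Fin (n + 1)) ℍ[ℝ])ˣ where
  carrier := {A | ∀ z w, hermForm n (A.val *ᵥ z) (A.val *ᵥ w) = hermForm n z w}
  one_mem' := by intro z w; simp
  mul_mem' := by
    intro A B hA hB z w
    have h := hA (B.val *ᵥ z) (B.val *ᵥ w)
    rw [Matrix.mulVec_mulVec, Matrix.mulVec_mulVec] at h
    exact h.trans (hB z w)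
  inv_mem' := by
    intro A hA z w
    have h := hA (A.inv *ᵥ z) (A.inv *ᵥ w)
    rw [Matrix.mulVec_mulVec, Matrix.mulVec_mulVec, A.val_inv, Matrix.one_mulVec,
      Matrix.one_mulVec] at h
    exact h.symm

/-- The matrix form of the definition. -/
theorem mem_Sp_iff (n : ℕ) (A : (Matrix (Fin (n + 1)) (Fin (n + 1)) ℍ[ℝ])ˣ) :
    A ∈ Sp n ↔ A.valᴴ * formMatrix n * A.val = formMatrix n := by
  have key : ∀ z w : Fin (n + 1) → ℍ[ℝ], hermForm n (A.val *ᵥ z) (A.val *ᵥ w)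
      = star w ⬝ᵥ ((A.valᴴ * formMatrix n * A.val) *ᵥ z) := by
    intro z w
    rw [hermForm, Matrix.star_mulVec, ← Matrix.dotProduct_mulVec, Matrix.mulVec_mulVec,
      Matrix.mulVec_mulVec, Matrix.mul_assoc]
  constructor
  · intro h
    ext1 i j
    have h1 := h (Pi.single j 1) (Pi.single i 1)
    rw [key, hermForm] at h1
    have hs : star (Pi.single i (1 : ℍ[ℝ]) : Fin (n + 1) → ℍ[ℝ]) = Pi.single i 1 := by
      rw [← Pi.single_star, star_one]
    simpa [hs] using h1
  · intro h z w
    rw [key, h, hermForm]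

theorem neg_one_mem_Sp (n : ℕ) : (-1 : (Matrix (Fin (n + 1)) (Fin (n + 1)) ℍ[ℝ])ˣ) ∈ Sp n := by
  rw [mem_Sp_iff]; simp

/-- The subgroup `{±I}` of `Sp(n,1)`. -/
def pmOne (n : ℕ) : Subgroup (Sp n) where
  carrier := {A | A = 1 ∨ A = ⟨-1, neg_one_mem_Sp n⟩}
  one_mem' := Or.inl rfl
  mul_mem' := by
    rintro A B (rfl | rfl) (rfl | rfl)
    · exact Or.inl (one_mul _)
    · exact Or.inr (one_mul _)
    · exact Or.inr (mul_one _)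
    · exact Or.inl (Subtype.ext (by simp))
  inv_mem' := by
    rintro A (rfl | rfl)
    · exact Or.inl inv_one
    · exact Or.inr (Subtype.ext (by simp))

instance pmOne_normal (n : ℕ) : (pmOne n).Normal where
  conj_mem := by
    rintro A (rfl | rfl) g
    · exact Or.inl (by simp)
    · exact Or.inr (Subtype.ext (by simp))

/-- `PSp(n,1) = Sp(n,1)/{±I}`, with the quotient of the subspace topology from matrices. -/
abbrev PSp (n : ℕ) : Type := Sp n ⧸ pmOne n

/-- `(g₁, g₂)` is strongly doubly reversible: some `h` with `h² = 1` conjugates each `gᵢ` to its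
inverse. -/
def StronglyDoublyReversible {G : Type*} [Group G] (g₁ g₂ : G) : Prop :=
  ∃ h : G, h ^ 2 = 1 ∧ h * g₁ * h⁻¹ = g₁⁻¹ ∧ h * g₂ * h⁻¹ = g₂⁻¹

end QuatHyp

/-!
Strong double reversibility of `(g₁, g₂)` means `g₁ = h k₁` and `g₂ = h k₂` with involutions
`h, k₁, k₂`. Lifted to the isometry group of the Hermitian form, these are square roots of `±1`.
Near a unitary `h` in a finite-dimensional real star algebra, the unitary square roots of `h²` are
`exp(X) h` with `X` skew-adjoint and anticommuting with `h`. If such `X` form a space of dimension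
at most `a`, the lifted set of pairs is covered by countably many smooth images of sets of Hausdorff
dimension at most `3a`.

A Borel set whose preimage in the unitary group has Hausdorff dimension smaller than that of the Lie
algebra is Haar null. By Fubini it suffices that all its translates be null for one nonzero measure,
and the image under `exp` of Hausdorff measure near `0` in the Lie algebra is such a measure.

Both dimensions are traces of projections built from `X ↦ X*` and `X ↦ h X h*`. For quaternionic
matrices of size `N` the Lie algebra has dimension `N(2N + 1)` and `a = N(N + 1)`, so
`3a < 2N(2N + 1)` as soon as `N ≥ 2`.
-/

namespace QuatHyp

open Module NormedSpace Topology
open scoped NNReal ENNReal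

section Eigenspaces

variable {K V : Type*} [Field K] [NeZero (2 : K)] [AddCommGroup V] [Module K V]
  [FiniteDimensional K V] {S T : End K V}

theorem four_mul_finrank_eigenspace_inf_eigenspace (hS : S * S = 1) (hT : T * T = 1)
    (hST : Commute S T) :
    4 * (finrank K ↥(S.eigenspace (-1) ⊓ T.eigenspace (-1)) : K) =
      finrank K V - LinearMap.trace K V S - LinearMap.trace K V T
        + LinearMap.trace K V (S * T) := by
  have h4 : (4 : K) ≠ 0 := by
    rw [show (4 : K) = 2 * 2 by norm_num]
    exact mul_ne_zero two_ne_zero two_ne_zero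
  have hproj : LinearMap.IsProj (S.eigenspace (-1) ⊓ T.eigenspace (-1))
      ((4 : K)⁻¹ • ((1 - S) * (1 - T))) := by
    have hS' : S * ((1 - S) * (1 - T)) = -((1 - S) * (1 - T)) := by
      rw [← mul_assoc, mul_sub S, mul_one, hS, ← neg_sub, neg_mul]
    have hT' : T * ((1 - S) * (1 - T)) = -((1 - S) * (1 - T)) := by
      rw [← mul_assoc, ← ((Commute.one_left T).sub_left hST).eq, mul_assoc, mul_sub T, mul_one, hT,
        ← neg_sub 1 T, mul_neg]
    constructor
    · intro x
      simp only [Submodule.mem_inf, End.mem_eigenspace_iff, neg_smul, one_smul]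
      constructor <;> rw [LinearMap.smul_apply, map_smul, ← End.mul_apply]
      · rw [hS', LinearMap.neg_apply, smul_neg]
      · rw [hT', LinearMap.neg_apply, smul_neg]
    · rintro x ⟨hSx, hTx⟩
      simp only [SetLike.mem_coe, End.mem_eigenspace_iff, neg_smul, one_smul] at hSx hTx
      have : ((1 - S) * (1 - T)) x = (4 : K) • x := by
        simp only [End.mul_apply, LinearMap.sub_apply, End.one_apply, hSx, hTx, map_sub, map_neg]
        module
      rw [LinearMap.smul_apply, this, inv_smul_smul₀ h4]
  have htrace := hproj.trace
  rw [map_smul, smul_eq_mul, mul_sub, sub_mul, sub_mul, one_mul, one_mul, mul_one, map_sub, map_sub,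
    map_sub, LinearMap.trace_one] at htrace
  rw [← htrace, mul_inv_cancel_left₀ h4]
  ring

theorem two_mul_finrank_eigenspace (hS : S * S = 1) :
    2 * (finrank K (S.eigenspace (-1)) : K) = finrank K V - LinearMap.trace K V S := by
  have h := four_mul_finrank_eigenspace_inf_eigenspace hS hS (Commute.refl S)
  rw [inf_idem, hS, LinearMap.trace_one] at h
  refine mul_left_cancel₀ (two_ne_zero (α := K)) ?_
  linear_combination h

end Eigenspaces

section Trace

variable {ι : Type*}

theorem re_sum (s : Finset ι) (f : ι → ℍ[ℝ]) : (∑ i ∈ s, f i).re = ∑ i ∈ s, (f i).re :=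
  map_sum (QuaternionAlgebra.reₗ (-1 : ℝ) 0 (-1)) f s

variable [Fintype ι]

/-- The basis `1, i, j, k` of the quaternions. -/
noncomputable def quaternionBasis : Basis (Fin 4) ℝ ℍ[ℝ] :=
  QuaternionAlgebra.basisOneIJK (R := ℝ) (-1) 0 (-1)

theorem quaternionBasis_repr (q : ℍ[ℝ]) :
    ⇑(quaternionBasis.repr q) = ![q.re, q.imI, q.imJ, q.imK] := rfl

theorem quaternionBasis_components (k : Fin 4) :
    (quaternionBasis k).re = ![1, 0, 0, 0] k ∧ (quaternionBasis k).imI = ![0, 1, 0, 0] k ∧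
      (quaternionBasis k).imJ = ![0, 0, 1, 0] k ∧ (quaternionBasis k).imK = ![0, 0, 0, 1] k := by
  have hrepr (l : Fin 4) := congrFun (quaternionBasis_repr (quaternionBasis k)) l
  simp only [quaternionBasis.repr_self, Fin.forall_fin_succ] at hrepr
  fin_cases k <;> simpa [eq_comm] using hrepr

theorem quaternionBasis_matrix_repr (A : Matrix ι ι ℍ[ℝ]) (i j : ι) (k : Fin 4) :
    (quaternionBasis.matrix ι ι).repr A (i, j, k) = quaternionBasis.repr (A i j) k := by
  rw [Basis.matrix, Basis.map_repr, LinearEquiv.trans_apply, Basis.repr_reindex_apply]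
  exact (Pi.basis_repr (fun _ : ι => Pi.basis fun _ : ι => quaternionBasis) A ⟨i, ⟨j, k⟩⟩).trans
    (Pi.basis_repr (fun _ : ι => quaternionBasis) (A i) ⟨j, k⟩)

theorem re_trace_conjTranspose (X : Matrix ι ι ℍ[ℝ]) : Xᴴ.trace.re = X.trace.re := by
  rw [Matrix.trace_conjTranspose, Quaternion.re_star]

theorem re_trace_mul_comm (X Y : Matrix ι ι ℍ[ℝ]) : (X * Y).trace.re = (Y * X).trace.re := by
  simp only [Matrix.trace, Matrix.diag, Matrix.mul_apply, re_sum]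
  rw [Finset.sum_comm]
  refine Finset.sum_congr rfl fun i _ => Finset.sum_congr rfl fun j _ => ?_
  simp only [Quaternion.re_mul]
  ring

theorem trace_end_matrix_quaternion [DecidableEq ι] (T : End ℝ (Matrix ι ι ℍ[ℝ])) :
    LinearMap.trace ℝ _ T = ∑ i, ∑ j, ∑ k,
      quaternionBasis.repr (T (Matrix.single i j (quaternionBasis k)) i j) k := by
  simp only [LinearMap.trace_eq_matrix_trace ℝ (quaternionBasis.matrix ι ι), Matrix.trace,
    Matrix.diag, LinearMap.toMatrix_apply, Fintype.sum_prod_type, Basis.matrix_apply,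
    quaternionBasis_matrix_repr]

theorem mul_single_mul_apply [DecidableEq ι] (A B : Matrix ι ι ℍ[ℝ]) (i j k l : ι) (q : ℍ[ℝ]) :
    (A * Matrix.single i j q * B) k l = A k i * q * B j l := by
  simp [Matrix.mul_apply, Matrix.single_apply, ite_and]

theorem trace_mul_mul (T : End ℝ (Matrix ι ι ℍ[ℝ])) (A B : Matrix ι ι ℍ[ℝ])
    (hT : ∀ X, T X = A * X * B) :
    LinearMap.trace ℝ _ T = 4 * (A.trace.re * B.trace.re) := by
  classical
  have hre (a b : ℍ[ℝ]) : ∑ k, quaternionBasis.repr (a * quaternionBasis k * b) k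
      = 4 * (a.re * b.re) := by
    simp [Fin.sum_univ_four, quaternionBasis_repr, quaternionBasis_components]
    ring
  simp only [trace_end_matrix_quaternion, hT, mul_single_mul_apply, hre, Matrix.trace, Matrix.diag,
    re_sum, Finset.sum_mul_sum, ← Finset.mul_sum]

theorem trace_mul_conjTranspose_mul (T : End ℝ (Matrix ι ι ℍ[ℝ])) (A B : Matrix ι ι ℍ[ℝ])
    (hT : ∀ X, T X = A * Xᴴ * B) :
    LinearMap.trace ℝ _ T = -2 * (Aᴴ * B).trace.re := by
  classical
  have hre (a b : ℍ[ℝ]) : ∑ k, quaternionBasis.repr (a * star (quaternionBasis k) * b) k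
      = -2 * (star a * b).re := by
    simp [Fin.sum_univ_four, quaternionBasis_repr, quaternionBasis_components]
    ring
  simp only [trace_end_matrix_quaternion, hT, Matrix.conjTranspose_single, mul_single_mul_apply,
    hre]
  simp only [Matrix.trace, Matrix.diag, Matrix.mul_apply, Matrix.conjTranspose_apply, re_sum,
    Finset.mul_sum]
  exact Finset.sum_comm

end Trace

section Exp

variable {A : Type*} [NormedRing A] [NormedAlgebra ℝ A] [CompleteSpace A]

theorem exists_antilipschitzWith_domRestrict_exp :
    ∃ U ∈ 𝓝 (0 : A), ∃ K, AntilipschitzWith K (U.domRestrict exp) := by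
  have hexp : HasStrictFDerivAt exp (ContinuousLinearEquiv.refl ℝ A : A →L[ℝ] A) 0 :=
    hasStrictFDerivAt_exp_zero
  obtain ⟨U, h0, hU, happrox⟩ := hexp.approximates_deriv_on_open_nhds
  exact ⟨U, hU.mem_nhds h0, _, happrox.antilipschitz <|
    (ContinuousLinearEquiv.refl ℝ A).subsingleton_or_nnnorm_symm_pos.imp id fun hpos =>
      NNReal.half_lt_self (inv_pos.2 hpos).ne'⟩

theorem map_exp_nhds_zero : Filter.map exp (𝓝 (0 : A)) = 𝓝 1 := by
  have hexp : HasStrictFDerivAt exp (ContinuousLinearEquiv.refl ℝ A : A →L[ℝ] A) 0 :=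
    hasStrictFDerivAt_exp_zero
  rw [hexp.map_nhds_eq_of_equiv, exp_zero]

theorem contDiff_exp {n : WithTop ℕ∞} : ContDiff ℝ n (exp : A → A) :=
  contDiff_iff_contDiffAt.2 fun X => (exp_analytic X).contDiffAt

end Exp

section SquareRoots

variable {A : Type*} [NormedRing A] [NormedAlgebra ℝ A] [StarRing A] [StarModule ℝ A]

/-- The skew-adjoint elements that anticommute with `h`. For `h` unitary, this is the tangent
space, translated by `h⁻¹`, of the set of unitary square roots of `h * h`. -/
noncomputable def skewAnticommutant (h : A) : Submodule ℝ A :=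
  skewAdjoint.submodule ℝ A ⊓ LinearMap.ker (LinearMap.mulLeft ℝ h + LinearMap.mulRight ℝ h)

theorem mem_skewAnticommutant {h X : A} :
    X ∈ skewAnticommutant h ↔ star X = -X ∧ h * X = -(X * h) := by
  simp only [skewAnticommutant, Submodule.mem_inf, LinearMap.mem_ker, LinearMap.add_apply,
    LinearMap.mulLeft_apply, LinearMap.mulRight_apply, add_eq_zero_iff_eq_neg]
  rfl

variable [ContinuousStar A]

theorem exists_nhds_eq_exp_mul_of_mul_self_eq [CompleteSpace A] {h : A} (hh : h ∈ unitary A) :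
    ∃ W ∈ 𝓝 h, ∀ g ∈ W, g ∈ unitary A → g * g = h * h →
      ∃ X ∈ skewAnticommutant h, g = exp X * h := by
  let _ : NormedAlgebra ℚ A := .restrictScalars ℚ ℝ A
  obtain ⟨U, hU, K, hK⟩ := exists_antilipschitzWith_domRestrict_exp (A := A)
  have hinj : U.InjOn exp := Set.injOn_iff_injective.2 hK.injective
  have hU' {f : A → A} (hf : Continuous f) (h0 : f 0 = 0) : f ⁻¹' U ∈ 𝓝 0 :=
    hf.continuousAt.preimage_mem_nhds (by rwa [h0])
  let V : Set A := {X | -X ∈ U ∧ star X ∈ U ∧ h * X * star h ∈ U}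
  have hV : V ∈ 𝓝 0 := Filter.inter_mem (hU' continuous_neg neg_zero) <|
    Filter.inter_mem (hU' continuous_star (star_zero A)) (hU' (by fun_prop) (by simp))
  refine ⟨(· * star h) ⁻¹' (exp '' V), ?_, ?_⟩
  · refine (continuous_mul_const _).continuousAt.preimage_mem_nhds ?_
    rw [Unitary.mul_star_self_of_mem hh, ← map_exp_nhds_zero]
    exact Filter.image_mem_map hV
  rintro g ⟨X, ⟨hneg, hstar, hconj⟩, hX⟩ hg hgh
  simp only at hX
  have hunit : exp X ∈ unitary A := hX ▸ mul_mem hg (Unitary.star_mem hh)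
  have hexp_neg : exp (-X) = star (exp X) := by
    rw [← Ring.inverse_exp]
    exact Ring.inverse_unit (Unitary.toUnits ⟨exp X, hunit⟩)
  have hexp_conj : exp (h * X * star h) = star (exp X) := by
    have hstar_g : g * star h * star h = star g := by
      rw [mul_assoc, ← star_mul, ← hgh, star_mul, ← mul_assoc, Unitary.mul_star_self_of_mem hg,
        one_mul]
    refine (exp_units_conj (Unitary.toUnits ⟨h, hh⟩) X).trans ?_
    change h * exp X * star h = _
    rw [hX, mul_assoc, hstar_g, star_mul, star_star]
  refine ⟨X, mem_skewAnticommutant.2 ⟨hinj hstar hneg ?_, ?_⟩, ?_⟩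
  · rw [← star_exp, hexp_neg]
  · have := hinj hconj hneg (hexp_conj.trans hexp_neg.symm)
    rw [← neg_mul, ← this, mul_assoc, Unitary.star_mul_self_of_mem hh, mul_one]
  · rw [hX, mul_assoc, Unitary.star_mul_self_of_mem hh, mul_one]

theorem dimH_unitary_mul_self_eq_le [FiniteDimensional ℝ A] {s : A} {a : ℕ}
    (ha : ∀ h ∈ unitary A, h * h = s → finrank ℝ (skewAnticommutant h) ≤ a) :
    dimH {g | g ∈ unitary A ∧ g * g = s} ≤ a := by
  have := FiniteDimensional.complete ℝ A
  have := FiniteDimensional.proper ℝ A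
  by_contra! hlt
  obtain ⟨h, ⟨hh, hs⟩, hlocal⟩ := exists_mem_nhdsWithin_lt_dimH_of_lt_dimH hlt
  obtain ⟨W, hW, hparam⟩ := exists_nhds_eq_exp_mul_of_mul_self_eq hh
  refine (hlocal _ (inter_mem_nhdsWithin _ hW)).not_ge ?_
  have hsmooth : ContDiff ℝ 1 fun X : skewAnticommutant h => exp (X : A) * h :=
    (contDiff_exp.comp (skewAnticommutant h).subtypeL.contDiff).mul contDiff_const
  calc dimH ({g | g ∈ unitary A ∧ g * g = s} ∩ W)
      ≤ dimH (Set.range fun X : skewAnticommutant h => exp (X : A) * h) := by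
        refine dimH_mono ?_
        rintro g ⟨⟨hg, hgs⟩, hgW⟩
        obtain ⟨X, hX, rfl⟩ := hparam g hgW hg (hgs.trans hs.symm)
        exact ⟨⟨X, hX⟩, rfl⟩
    _ ≤ finrank ℝ (skewAnticommutant h) := hsmooth.dimH_range_le
    _ ≤ a := mod_cast ha h hh hs

end SquareRoots

section Haar

open MeasureTheory

theorem dimH_le_dimH_image_of_antilipschitzWith_domRestrict {X Y : Type*} [EMetricSpace X]
    [EMetricSpace Y] {K : ℝ≥0} {f : X → Y} {U S : Set X}
    (hf : AntilipschitzWith K (U.domRestrict f)) (hS : S ⊆ U) : dimH S ≤ dimH (f '' S) := by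
  have himage : U.domRestrict f '' (Subtype.val ⁻¹' S) = f '' S := by
    rw [Set.domRestrict_eq, Set.image_comp, Subtype.image_preimage_coe, Set.inter_eq_right.2 hS]
  rw [← himage, ← Set.inter_eq_right.2 hS, ← Subtype.image_preimage_coe,
    isometry_subtype_coe.dimH_image]
  simpa using hf.le_dimH_image _

theorem measure_eq_zero_of_forall_translate {G Ω : Type*} [Group G] [MeasurableSpace G]
    [MeasurableMul₂ G] [MeasurableInv G] (μ : Measure G) [SFinite μ] [μ.IsMulLeftInvariant]
    [MeasurableSpace Ω] (ν : Measure Ω) [SFinite ν] [NeZero ν] {Φ : Ω → G} (hΦ : Measurable Φ)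
    {E : Set G} (hE : MeasurableSet E) (hnull : ∀ x, ν {ω | x * Φ ω ∈ E} = 0) : μ E = 0 := by
  have hmeas : MeasurableSet {p : G × Ω | p.1 * Φ p.2 ∈ E} :=
    (measurable_fst.mul (hΦ.comp measurable_snd)) hE
  have hprod : (μ.prod ν) {p | p.1 * Φ p.2 ∈ E} = 0 := by
    rw [Measure.measure_prod_null hmeas]
    exact .of_forall hnull
  have hae : ∀ᵐ ω ∂ν, μ {x | x * Φ ω ∈ E} = 0 :=
    Measure.measure_ae_null_of_prod_null <|
      (Measure.measurePreserving_swap.measure_preimage hmeas.nullMeasurableSet).trans hprod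
  obtain ⟨ω, hω⟩ := hae.exists
  exact (measure_mul_right_null μ (Φ ω)).1 hω

variable {A : Type*} [NormedRing A] [NormedAlgebra ℝ A] [StarRing A] [StarModule ℝ A]
  [ContinuousStar A]

/-- The exponential map of the unitary group, from the skew-adjoint elements. -/
noncomputable def expUnitary [CompleteSpace A] (X : skewAdjoint.submodule ℝ A) : unitary A :=
  ⟨exp (X : A), let _ : NormedAlgebra ℚ A := .restrictScalars ℚ ℝ A
    exp_mem_unitary_of_mem_skewAdjoint X.2⟩

theorem continuous_expUnitary [CompleteSpace A] :
    Continuous (expUnitary : skewAdjoint.submodule ℝ A → unitary A) :=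
  ((contDiff_exp (n := 0)).continuous.comp continuous_subtype_val).subtype_mk _

variable (A) in
theorem exists_nhds_forall_dimH_translate_le [CompleteSpace A] :
    ∃ U ∈ 𝓝 (0 : skewAdjoint.submodule ℝ A), ∀ (u : unitary A) (E : Set (unitary A)),
      dimH ({X | u * expUnitary X ∈ E} ∩ U) ≤ dimH ((↑) '' E : Set A) := by
  obtain ⟨U, hU, K, hK⟩ := exists_antilipschitzWith_domRestrict_exp (A := A)
  refine ⟨(↑) ⁻¹' U, continuous_subtype_val.continuousAt.preimage_mem_nhds hU, fun u E => ?_⟩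
  set S := {X : skewAdjoint.submodule ℝ A | u * expUnitary X ∈ E} ∩ (↑) ⁻¹' U
  calc dimH S = dimH ((↑) '' S : Set A) := (isometry_subtype_coe.dimH_image S).symm
    _ ≤ dimH (exp '' ((↑) '' S : Set A)) :=
      dimH_le_dimH_image_of_antilipschitzWith_domRestrict hK (by rintro _ ⟨X, hX, rfl⟩; exact hX.2)
    _ ≤ dimH (ContinuousLinearMap.mul ℝ A (star u) '' ((↑) '' E)) := by
      refine dimH_mono ?_
      rintro _ ⟨_, ⟨X, hX, rfl⟩, rfl⟩
      refine ⟨_, ⟨_, hX.1, rfl⟩, ?_⟩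
      simp [expUnitary, ← mul_assoc]
    _ ≤ dimH ((↑) '' E : Set A) := (ContinuousLinearMap.lipschitz _).dimH_image_le _

theorem measure_eq_zero_of_dimH_lt [FiniteDimensional ℝ A] {G : Type*} [Group G]
    [TopologicalSpace G] [IsTopologicalGroup G] [SecondCountableTopology G] [MeasurableSpace G]
    [BorelSpace G] (μ : Measure G) [SFinite μ] [μ.IsMulLeftInvariant]
    {π : unitary A →* G} (hπ : Continuous π) (hsurj : Function.Surjective π)
    {E : Set G} (hE : MeasurableSet E)
    (hdim : dimH ((↑) '' (π ⁻¹' E) : Set A) < finrank ℝ (skewAdjoint.submodule ℝ A)) :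
    μ E = 0 := by
  have := FiniteDimensional.complete ℝ A
  let _ : MeasurableSpace (skewAdjoint.submodule ℝ A) := borel _
  have : BorelSpace (skewAdjoint.submodule ℝ A) := ⟨rfl⟩
  obtain ⟨U, hU, hUdim⟩ := exists_nhds_forall_dimH_translate_le A
  set d := finrank ℝ (skewAdjoint.submodule ℝ A) with hd
  have : NeZero (μH[d].restrict U) := ⟨by
    rw [Ne, Measure.restrict_eq_zero, hd]
    exact (Measure.measure_pos_of_mem_nhds _ hU).ne'⟩
  have hΦ : Measurable fun X => π (expUnitary X) := (hπ.comp continuous_expUnitary).measurable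
  have hsf : SFinite (μH[d].restrict U) := by rw [hd]; infer_instance
  refine measure_eq_zero_of_forall_translate μ (μH[d].restrict U) hΦ hE fun x => ?_
  obtain ⟨u, rfl⟩ := hsurj x
  have hmeas : MeasurableSet {X | π u * π (expUnitary X) ∈ E} := hΦ.const_mul _ hE
  have hlt := (hUdim u (π ⁻¹' E)).trans_lt hdim
  simp only [Set.mem_preimage, map_mul] at hlt
  have hzero := hausdorffMeasure_of_dimH_lt (d := d) (mod_cast hlt)
  rw [Measure.restrict_apply hmeas]
  exact mod_cast hzero

end Haar

section Prod

theorem finrank_submodule_prod {K V W : Type*} [Field K] [AddCommGroup V] [AddCommGroup W]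
    [Module K V] [Module K W] [FiniteDimensional K V] [FiniteDimensional K W]
    (p : Submodule K V) (q : Submodule K W) :
    finrank K (p.prod q) = finrank K p + finrank K q := by
  have hinj : Function.Injective (p.subtype.prodMap q.subtype) :=
    p.subtype_injective.prodMap q.subtype_injective
  rw [← finrank_prod, ← LinearMap.finrank_range_of_inj hinj, LinearMap.range_prodMap,
    p.range_subtype, q.range_subtype]

theorem mem_unitary_prod {A B : Type*} [Monoid A] [StarMul A] [Monoid B] [StarMul B]
    {x : A × B} : x ∈ unitary (A × B) ↔ x.1 ∈ unitary A ∧ x.2 ∈ unitary B := by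
  simp only [Unitary.mem_iff, Prod.ext_iff, Prod.fst_mul, Prod.snd_mul, Prod.fst_star,
    Prod.snd_star, Prod.fst_one, Prod.snd_one]
  tauto

/-- The unitary group of a product is the product of the unitary groups. -/
def unitaryProdEquiv (A B : Type*) [Monoid A] [StarMul A] [Monoid B] [StarMul B]
    [TopologicalSpace A] [TopologicalSpace B] :
    unitary (A × B) ≃ₜ* unitary A × unitary B where
  toFun u := (⟨u.1.1, (mem_unitary_prod.1 u.2).1⟩, ⟨u.1.2, (mem_unitary_prod.1 u.2).2⟩)
  invFun u := ⟨(u.1, u.2), mem_unitary_prod.2 ⟨u.1.2, u.2.2⟩⟩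
  map_mul' _ _ := rfl
  continuous_toFun := ((continuous_fst.comp continuous_subtype_val).subtype_mk _).prodMk
    ((continuous_snd.comp continuous_subtype_val).subtype_mk _)
  continuous_invFun := ((continuous_subtype_val.comp continuous_fst).prodMk
    (continuous_subtype_val.comp continuous_snd)).subtype_mk _

variable {A B : Type*} [NormedRing A] [NormedAlgebra ℝ A] [StarRing A] [StarModule ℝ A]
  [NormedRing B] [NormedAlgebra ℝ B] [StarRing B] [StarModule ℝ B]

variable (A B) in
theorem submodule_skewAdjoint_prod : skewAdjoint.submodule ℝ (A × B) =
    (skewAdjoint.submodule ℝ A).prod (skewAdjoint.submodule ℝ B) := by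
  ext x
  exact Prod.ext_iff

theorem skewAnticommutant_prod (h : A × B) :
    skewAnticommutant h = (skewAnticommutant h.1).prod (skewAnticommutant h.2) := by
  ext x
  simp only [Submodule.mem_prod, mem_skewAnticommutant, Prod.ext_iff, Prod.fst_star, Prod.snd_star,
    Prod.fst_mul, Prod.snd_mul, Prod.fst_neg, Prod.snd_neg]
  tauto

end Prod

section Reversible

theorem stronglyDoublyReversible_iff_exists_involutions {G : Type*} [Group G] {g₁ g₂ : G} :
    StronglyDoublyReversible g₁ g₂ ↔ ∃ h k₁ k₂ : G, h * h = 1 ∧ k₁ * k₁ = 1 ∧ k₂ * k₂ = 1 ∧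
      h * k₁ = g₁ ∧ h * k₂ = g₂ := by
  have hconj {h g : G} (hh : h * h = 1) : h * g * h⁻¹ = g⁻¹ ↔ h * g * (h * g) = 1 := by
    rw [inv_eq_of_mul_eq_one_right hh, eq_inv_iff_mul_eq_one, ← mul_assoc]
  constructor
  · rintro ⟨h, hh, h₁, h₂⟩
    rw [pow_two] at hh
    exact ⟨h, h * g₁, h * g₂, hh, (hconj hh).1 h₁, (hconj hh).1 h₂,
      by rw [← mul_assoc, hh, one_mul], by rw [← mul_assoc, hh, one_mul]⟩
  · rintro ⟨h, k₁, k₂, hh, h₁, h₂, rfl, rfl⟩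
    refine ⟨h, (pow_two h).trans hh, (hconj hh).2 ?_, (hconj hh).2 ?_⟩ <;>
      rwa [← mul_assoc h, hh, one_mul]

theorem measurableSet_stronglyDoublyReversible {G : Type*} [Group G] [TopologicalSpace G]
    [ContinuousMul G] [T2Space G] [SigmaCompactSpace G] [MeasurableSpace (G × G)]
    [BorelSpace (G × G)] :
    MeasurableSet {p : G × G | StronglyDoublyReversible p.1 p.2} := by
  have himage : {p : G × G | StronglyDoublyReversible p.1 p.2} =
      (fun t : G × G × G => (t.1 * t.2.1, t.1 * t.2.2)) '' {t | t * t = 1} := by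
    ext ⟨g₁, g₂⟩
    simp only [Set.mem_ofPred_eq, stronglyDoublyReversible_iff_exists_involutions, Set.mem_image,
      Prod.exists, Prod.mk_mul_mk, Prod.mk_eq_one, Prod.mk.injEq, and_assoc]
  have hclosed : IsClosed {t : G × G × G | t * t = 1} :=
    isClosed_eq (continuous_id.mul continuous_id) continuous_const
  obtain ⟨K, hK, hunion⟩ := (isSigmaCompact_univ.of_isClosed_subset hclosed
    (Set.subset_univ _)).image (by fun_prop : Continuous fun t : G × G × G =>
      (t.1 * t.2.1, t.1 * t.2.2))
  rw [himage, ← hunion]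
  exact .iUnion fun i => (hK i).measurableSet

variable {G : Type*} [Group G]

theorem image_preimage_stronglyDoublyReversible_subset {M : Type*} [Monoid M] [StarMul M]
    {π : unitary M →* G} (hπ : Function.Surjective π) :
    (fun p : unitary M × unitary M => ((p.1, p.2) : M × M)) ''
        {p | StronglyDoublyReversible (π p.1) (π p.2)} ⊆
      ⋃ s ∈ ((↑) '' (π.ker : Set (unitary M)) : Set M) ×ˢ
          ((↑) '' (π.ker : Set (unitary M)) : Set M) ×ˢ ((↑) '' (π.ker : Set (unitary M)) : Set M),
        (fun t : M × M × M => (t.1 * t.2.1, t.1 * t.2.2)) ''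
          {t | t ∈ unitary (M × M × M) ∧ t * t = s} := by
  rintro _ ⟨⟨g₁, g₂⟩, hrev, rfl⟩
  obtain ⟨h', k₁, k₂, hh, hk₁, hk₂, hg₁, hg₂⟩ :=
    stronglyDoublyReversible_iff_exists_involutions.1 hrev
  obtain ⟨h, rfl⟩ := hπ h'
  have hker {k : unitary M} (hk : π k * π k = 1) : k * k ∈ π.ker := by rwa [π.mem_ker, map_mul]
  have hlift {g : unitary M} {k : G} (hg : π h * k = π g) (hk : k * k = 1) :
      h⁻¹ * g * (h⁻¹ * g) ∈ π.ker :=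
    hker (by rwa [map_mul, map_inv, ← hg, inv_mul_cancel_left])
  let t : M × M × M := (h, (h⁻¹ * g₁ : unitary M), (h⁻¹ * g₂ : unitary M))
  refine Set.mem_biUnion (x := t * t)
    ⟨⟨_, hker hh, rfl⟩, ⟨_, hlift hg₁ hk₁, rfl⟩, ⟨_, hlift hg₂ hk₂, rfl⟩⟩
    ⟨t, ⟨?_, rfl⟩, ?_⟩
  · exact mem_unitary_prod.2 ⟨h.2, mem_unitary_prod.2 ⟨(h⁻¹ * g₁).2, (h⁻¹ * g₂).2⟩⟩
  · simp only [t, ← Submonoid.coe_mul, mul_inv_cancel_left]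

variable {A : Type*} [NormedRing A] [NormedAlgebra ℝ A] [StarRing A] [StarModule ℝ A]
  [ContinuousStar A] [FiniteDimensional ℝ A]

theorem dimH_preimage_stronglyDoublyReversible_le {π : unitary A →* G}
    (hπ : Function.Surjective π) (hker : (π.ker : Set (unitary A)).Countable) {a : ℕ}
    (ha : ∀ h : unitary A, h * h ∈ π.ker → finrank ℝ (skewAnticommutant (h : A)) ≤ a) :
    dimH ((fun p : unitary A × unitary A => ((p.1, p.2) : A × A)) ''
      {p | StronglyDoublyReversible (π p.1) (π p.2)}) ≤ (3 * a : ℕ) := by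
  have hker' : ((↑) '' (π.ker : Set (unitary A)) : Set A).Countable := hker.image _
  have ha' {h : A} (hh : h ∈ unitary A) (hs : h * h ∈ ((↑) '' (π.ker : Set (unitary A)) : Set A)) :
      finrank ℝ (skewAnticommutant h) ≤ a := by
    obtain ⟨s, hs, heq⟩ := hs
    rw [show s = ⟨h, hh⟩ * ⟨h, hh⟩ from Subtype.ext heq] at hs
    exact ha ⟨h, hh⟩ hs
  refine (dimH_mono (image_preimage_stronglyDoublyReversible_subset hπ)).trans ?_
  rw [dimH_bUnion (hker'.prod (hker'.prod hker'))]
  refine iSup₂_le fun s ⟨hs, hs₁, hs₂⟩ => ?_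
  have hsmooth : ContDiff ℝ 1 fun t : A × A × A => (t.1 * t.2.1, t.1 * t.2.2) := by fun_prop
  refine (hsmooth.contDiffOn.dimH_image_le convex_univ (Set.subset_univ _)).trans ?_
  refine dimH_unitary_mul_self_eq_le ?_
  rintro ⟨h, k₁, k₂⟩ hunit rfl
  obtain ⟨hh, hk₁, hk₂⟩ : h ∈ unitary A ∧ k₁ ∈ unitary A ∧ k₂ ∈ unitary A := by
    simpa only [mem_unitary_prod] using hunit
  rw [skewAnticommutant_prod, finrank_submodule_prod, skewAnticommutant_prod,
    finrank_submodule_prod]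
  have := ha' hh hs
  have := ha' hk₁ hs₁
  have := ha' hk₂ hs₂
  lia

open MeasureTheory in
theorem measure_stronglyDoublyReversible_eq_zero [TopologicalSpace G] [IsTopologicalGroup G]
    [T2Space G] [MeasurableSpace (G × G)] [BorelSpace (G × G)] (μ : Measure (G × G))
    [μ.IsHaarMeasure] {π : unitary A →* G} (hπ : IsOpenQuotientMap π)
    (hker : (π.ker : Set (unitary A)).Countable) {a : ℕ}
    (ha : ∀ h : unitary A, h * h ∈ π.ker → finrank ℝ (skewAnticommutant (h : A)) ≤ a)
    (hlt : 3 * a < 2 * finrank ℝ (skewAdjoint.submodule ℝ A)) :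
    μ {p | StronglyDoublyReversible p.1 p.2} = 0 := by
  have := FiniteDimensional.proper ℝ A
  have : SigmaCompactSpace (unitary A) := isClosed_unitary.sigmaCompactSpace
  have : SigmaCompactSpace G := isSigmaCompact_univ_iff.1 <|
    hπ.surjective.range_eq ▸ isSigmaCompact_range hπ.continuous
  have : SecondCountableTopology G := hπ.isQuotientMap.secondCountableTopology hπ.isOpenMap
  let Φ : unitary (A × A) →* G × G := (π.prodMap π).comp (unitaryProdEquiv A A)
  have hΦ : IsOpenQuotientMap Φ :=
    (hπ.prodMap hπ).comp (unitaryProdEquiv A A).toHomeomorph.isOpenQuotientMap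
  refine measure_eq_zero_of_dimH_lt μ hΦ.continuous hΦ.surjective
    measurableSet_stronglyDoublyReversible ?_
  rw [submodule_skewAdjoint_prod, finrank_submodule_prod, ← two_mul]
  refine lt_of_le_of_lt ?_ (Nat.cast_lt.2 hlt)
  refine (dimH_mono ?_).trans (dimH_preimage_stronglyDoublyReversible_le hπ.surjective hker ha)
  rintro _ ⟨u, hu, rfl⟩
  exact ⟨unitaryProdEquiv A A u, hu, rfl⟩

end Reversible

section StarTrace

variable {A : Type*} [NormedRing A] [NormedAlgebra ℝ A] [StarRing A]

/-- The linear map `X ↦ h X h*`, which is the conjugation by `h` when `h` is unitary. -/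
noncomputable def conjEnd (h : A) : End ℝ A := LinearMap.mulLeftRight ℝ (h, star h)

theorem conjEnd_apply (h X : A) : conjEnd h X = h * X * star h :=
  LinearMap.mulLeftRight_apply h (star h) X

variable [StarModule ℝ A]

variable (A) in
/-- The star operation of a real star algebra, as a linear map. -/
def starEnd : End ℝ A where
  toFun := star
  map_add' := star_add
  map_smul' := star_smul

variable (A) in
theorem starEnd_mul_self : starEnd A * starEnd A = 1 :=
  LinearMap.ext star_star

variable (A) in
theorem submodule_skewAdjoint_eq_eigenspace :
    skewAdjoint.submodule ℝ A = (starEnd A).eigenspace (-1) := by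
  ext X
  rw [End.mem_eigenspace_iff, neg_one_smul]
  rfl

theorem skewAnticommutant_eq_eigenspace_inf_eigenspace {h : A} (hh : h ∈ unitary A) :
    skewAnticommutant h = (starEnd A).eigenspace (-1) ⊓ (conjEnd h).eigenspace (-1) := by
  ext X
  have hconj : h * X * star h = -X ↔ h * X = -(X * h) := by
    constructor <;> intro hX
    · rw [← neg_mul, ← hX, mul_assoc, Unitary.star_mul_self_of_mem hh, mul_one]
    · rw [hX, neg_mul, mul_assoc, Unitary.mul_star_self_of_mem hh, mul_one]
  rw [mem_skewAnticommutant, Submodule.mem_inf, End.mem_eigenspace_iff, End.mem_eigenspace_iff,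
    neg_one_smul, conjEnd_apply, hconj]
  rfl

variable [FiniteDimensional ℝ A]

theorem four_mul_finrank_skewAnticommutant {h : A} (hh : h ∈ unitary A)
    (hcenter : h * h ∈ Subring.center A) :
    4 * (finrank ℝ (skewAnticommutant h) : ℝ) = finrank ℝ A - LinearMap.trace ℝ A (starEnd A)
      - LinearMap.trace ℝ A (conjEnd h) + LinearMap.trace ℝ A (starEnd A * conjEnd h) := by
  rw [skewAnticommutant_eq_eigenspace_inf_eigenspace hh]
  refine four_mul_finrank_eigenspace_inf_eigenspace (starEnd_mul_self A)
    (LinearMap.ext fun X => ?_) (LinearMap.ext fun X => ?_)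
  · simp only [End.mul_apply, conjEnd_apply, End.one_apply]
    calc h * (h * X * star h) * star h = h * h * X * star (h * h) := by
          simp only [star_mul, mul_assoc]
      _ = X * (h * h) * star (h * h) := by rw [Subring.mem_center_iff.1 hcenter X]
      _ = X := by rw [mul_assoc, Unitary.mul_star_self_of_mem (mul_mem hh hh), mul_one]
  · change star (conjEnd h X) = conjEnd h (star X)
    simp only [conjEnd_apply, star_mul, star_star, mul_assoc]

end StarTrace

section FormAlgebra

variable {ι : Type*} [Fintype ι] [DecidableEq ι]

/-- The nondegenerate Hermitian forms `⟨z, w⟩ = wᴴ J z` on `ℍ^ι`, encoded by their matrix `J`. -/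
abbrev NondegenerateHermitian (ι : Type*) [Fintype ι] [DecidableEq ι] :=
  {J : (Matrix ι ι ℍ[ℝ])ˣ // IsSelfAdjoint J}

namespace NondegenerateHermitian

variable (J : NondegenerateHermitian ι)

theorem conjTranspose_val : (J.1.val)ᴴ = J.1.val :=
  congrArg Units.val J.2

theorem conjTranspose_inv : (J.1⁻¹.val)ᴴ = J.1⁻¹.val :=
  congrArg Units.inv J.2

/-- The adjoint of a matrix for the Hermitian form `J`. -/
noncomputable def adjoint (X : Matrix ι ι ℍ[ℝ]) : Matrix ι ι ℍ[ℝ] := J.1⁻¹.val * Xᴴ * J.1.val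

theorem adjoint_adjoint (X : Matrix ι ι ℍ[ℝ]) : J.adjoint (J.adjoint X) = X := by
  simp [adjoint, J.conjTranspose_val, J.conjTranspose_inv, mul_assoc]

theorem adjoint_mul (X Y : Matrix ι ι ℍ[ℝ]) : J.adjoint (X * Y) = J.adjoint Y * J.adjoint X := by
  simp [adjoint, mul_assoc]

theorem adjoint_add (X Y : Matrix ι ι ℍ[ℝ]) : J.adjoint (X + Y) = J.adjoint X + J.adjoint Y := by
  simp [adjoint, mul_add, add_mul]

theorem adjoint_smul (c : ℝ) (X : Matrix ι ι ℍ[ℝ]) : J.adjoint (c • X) = c • J.adjoint X := by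
  have hsmul : (c • X)ᴴ = c • Xᴴ := Matrix.ext fun i j => Quaternion.star_smul c (X j i)
  rw [adjoint, hsmul, Matrix.mul_smul, Matrix.smul_mul, adjoint]

theorem re_trace_adjoint (X : Matrix ι ι ℍ[ℝ]) : (J.adjoint X).trace.re = X.trace.re := by
  rw [adjoint, mul_assoc, re_trace_mul_comm, mul_assoc, J.1.mul_inv, mul_one,
    re_trace_conjTranspose]

end NondegenerateHermitian

/-- The algebra of quaternionic matrices, with the involution sending a matrix to its adjoint for
the Hermitian form `J`. Its unitary elements are the isometries of the form. It carries the maximal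
row sum norm, but any submultiplicative norm would do. -/
def FormAlgebra (_J : NondegenerateHermitian ι) : Type _ := Matrix ι ι ℍ[ℝ]

namespace FormAlgebra

variable {J : NondegenerateHermitian ι}

noncomputable instance : NormedRing (FormAlgebra J) :=
  letI := Matrix.linftyOpNormedRing (n := ι) (α := ℍ[ℝ])
  inferInstanceAs (NormedRing (Matrix ι ι ℍ[ℝ]))

noncomputable instance : NormedAlgebra ℝ (FormAlgebra J) :=
  letI := Matrix.linftyOpNormedRing (n := ι) (α := ℍ[ℝ])
  letI := Matrix.linftyOpNormedAlgebra (n := ι) (R := ℝ) (α := ℍ[ℝ])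
  inferInstanceAs (NormedAlgebra ℝ (Matrix ι ι ℍ[ℝ]))

/-- The underlying matrix. -/
noncomputable def toMatrix : FormAlgebra J ≃ₐ[ℝ] Matrix ι ι ℍ[ℝ] := AlgEquiv.refl

instance : FiniteDimensional ℝ (FormAlgebra J) :=
  inferInstanceAs (FiniteDimensional ℝ (Matrix ι ι ℍ[ℝ]))

noncomputable instance : StarRing (FormAlgebra J) where
  star := J.adjoint
  star_involutive := J.adjoint_adjoint
  star_mul := J.adjoint_mul
  star_add := J.adjoint_add

instance : StarModule ℝ (FormAlgebra J) where
  star_smul := J.adjoint_smul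

instance : ContinuousStar (FormAlgebra J) where
  continuous_star := (starEnd (FormAlgebra J)).continuous_of_finiteDimensional

variable (J) in
theorem finrank_eq : finrank ℝ (FormAlgebra J) = 4 * Fintype.card ι ^ 2 := by
  refine (Module.finrank_matrix ℝ ℍ[ℝ] ι ι).trans ?_
  rw [Quaternion.finrank_eq_four]
  ring

variable (J) in
theorem trace_starEnd :
    LinearMap.trace ℝ (FormAlgebra J) (starEnd (FormAlgebra J)) = -2 * Fintype.card ι := by
  refine (trace_mul_conjTranspose_mul (starEnd (FormAlgebra J)) _ _ fun X => rfl).trans ?_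
  rw [J.conjTranspose_inv, J.1.inv_mul, Matrix.trace_one, Quaternion.re_natCast]

theorem trace_conjEnd (h : FormAlgebra J) :
    LinearMap.trace ℝ (FormAlgebra J) (conjEnd h) = 4 * (toMatrix h).trace.re ^ 2 := by
  refine (trace_mul_mul (conjEnd h) (toMatrix h) (J.adjoint (toMatrix h))
    (conjEnd_apply h)).trans ?_
  rw [J.re_trace_adjoint, pow_two]

theorem trace_starEnd_mul_conjEnd (h : FormAlgebra J) :
    LinearMap.trace ℝ (FormAlgebra J) (starEnd (FormAlgebra J) * conjEnd h) =
      -2 * (toMatrix (h * h)).trace.re := by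
  have hformula (X : FormAlgebra J) : toMatrix ((starEnd (FormAlgebra J) * conjEnd h) X) =
      toMatrix h * J.1⁻¹.val * (toMatrix X)ᴴ * (J.1.val * J.adjoint (toMatrix h)) := by
    change J.adjoint (toMatrix h * toMatrix X * J.adjoint (toMatrix h)) = _
    rw [J.adjoint_mul, J.adjoint_mul, J.adjoint_adjoint]
    simp only [NondegenerateHermitian.adjoint, mul_assoc]
  have hadjoint : (toMatrix h * J.1⁻¹.val)ᴴ * (J.1.val * J.adjoint (toMatrix h)) =
      J.adjoint (toMatrix (h * h)) := by
    rw [Matrix.conjTranspose_mul, J.conjTranspose_inv, ← mul_assoc, map_mul, J.adjoint_mul]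
    rfl
  refine (trace_mul_conjTranspose_mul (starEnd (FormAlgebra J) * conjEnd h) _ _ hformula).trans ?_
  rw [hadjoint, J.re_trace_adjoint]

variable (J) in
theorem finrank_skewAdjoint :
    finrank ℝ (skewAdjoint.submodule ℝ (FormAlgebra J)) =
      Fintype.card ι * (2 * Fintype.card ι + 1) := by
  have h := two_mul_finrank_eigenspace (starEnd_mul_self (FormAlgebra J))
  rw [← submodule_skewAdjoint_eq_eigenspace, finrank_eq, trace_starEnd] at h
  rw [← Nat.cast_inj (R := ℝ)]
  push_cast at h ⊢
  linarith

theorem finrank_skewAnticommutant_le {h : FormAlgebra J} (hh : h ∈ unitary (FormAlgebra J))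
    (hsq : h * h = 1 ∨ h * h = -1) :
    finrank ℝ (skewAnticommutant h) ≤ Fintype.card ι * (Fintype.card ι + 1) := by
  have hcenter : h * h ∈ Subring.center (FormAlgebra J) := by
    rcases hsq with hsq | hsq <;> rw [hsq]
    · exact one_mem _
    · exact neg_mem (one_mem _)
  have htrace : -(Fintype.card ι : ℝ) ≤ (toMatrix (h * h)).trace.re := by
    rcases hsq with hsq | hsq <;> simp [hsq]
  have hdim := four_mul_finrank_skewAnticommutant hh hcenter
  rw [finrank_eq, trace_starEnd, trace_conjEnd, trace_starEnd_mul_conjEnd] at hdim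
  rw [← Nat.cast_le (α := ℝ)]
  push_cast at hdim ⊢
  nlinarith [sq_nonneg (toMatrix h).trace.re]

end FormAlgebra
end FormAlgebra

section Sp

variable (n : ℕ)

theorem formMatrix_mul_self : formMatrix n * formMatrix n = 1 := by
  ext1 i j
  rw [Matrix.mul_apply, Finset.sum_eq_single (Equiv.swap 0 (Fin.last n) i)]
  · simp [formMatrix, Matrix.one_apply]
  · intro k _ hk
    simp [formMatrix, hk.symm]
  · simp

theorem conjTranspose_formMatrix : (formMatrix n)ᴴ = formMatrix n := by
  ext1 i j
  have hswap : Equiv.swap 0 (Fin.last n) j = i ↔ Equiv.swap 0 (Fin.last n) i = j := by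
    constructor <;> (rintro rfl; simp)
  simp only [formMatrix, Matrix.conjTranspose_apply, hswap]
  split_ifs <;> simp

/-- The form defining `Sp n`, as a nondegenerate Hermitian form. -/
noncomputable def spForm : NondegenerateHermitian (Fin (n + 1)) :=
  ⟨⟨formMatrix n, formMatrix n, formMatrix_mul_self n, formMatrix_mul_self n⟩,
    Units.ext (conjTranspose_formMatrix n)⟩

variable {n}

theorem mem_Sp_iff_mem_unitary {A : (Matrix (Fin (n + 1)) (Fin (n + 1)) ℍ[ℝ])ˣ}
    {X : FormAlgebra (spForm n)} (hX : FormAlgebra.toMatrix X = A.val) :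
    A ∈ Sp n ↔ X ∈ unitary (FormAlgebra (spForm n)) := by
  have hunit : IsUnit X := by
    rw [← MulEquiv.isUnit_map FormAlgebra.toMatrix, hX]
    exact A.isUnit
  rw [hunit.mem_unitary_iff_star_mul_self, mem_Sp_iff, ← hX]
  change _ ↔ (spForm n).1⁻¹.val * (FormAlgebra.toMatrix X)ᴴ * (spForm n).1.val *
    FormAlgebra.toMatrix X = 1
  rw [mul_assoc (spForm n).1⁻¹.val, mul_assoc (spForm n).1⁻¹.val, Units.inv_mul_eq_iff_eq_mul,
    mul_one]
  rfl

variable (n) in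
/-- `Sp n` is the isometry group of `spForm n`. -/
noncomputable def unitaryEquivSp : unitary (FormAlgebra (spForm n)) ≃* Sp n where
  toFun u := ⟨Units.map ((FormAlgebra.toMatrix (J := spForm n)) : _ →* _) (Unitary.toUnits u),
    (mem_Sp_iff_mem_unitary (X := u.1) rfl).2 u.2⟩
  invFun A := ⟨FormAlgebra.toMatrix.symm A.1.val,
    (mem_Sp_iff_mem_unitary (FormAlgebra.toMatrix.apply_symm_apply _)).1 A.2⟩
  left_inv _ := Subtype.ext (FormAlgebra.toMatrix.symm_apply_apply _)
  right_inv _ := Subtype.ext (Units.ext (FormAlgebra.toMatrix.apply_symm_apply _))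
  map_mul' u v := Subtype.ext (Units.ext (map_mul FormAlgebra.toMatrix u.1 v.1))

theorem continuous_unitaryEquivSp : Continuous (unitaryEquivSp n) := by
  have hcont : Continuous (FormAlgebra.toMatrix (J := spForm n)) :=
    FormAlgebra.toMatrix.toLinearMap.continuous_of_finiteDimensional
  refine Continuous.subtype_mk (Units.continuous_iff.2 ⟨?_, ?_⟩) _
  · exact hcont.comp continuous_subtype_val
  · exact hcont.comp (continuous_star.comp continuous_subtype_val)

theorem continuous_unitaryEquivSp_symm : Continuous (unitaryEquivSp n).symm := by
  have hcont : Continuous (FormAlgebra.toMatrix (J := spForm n)).symm :=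
    FormAlgebra.toMatrix.symm.toLinearMap.continuous_of_finiteDimensional
  exact (hcont.comp (Units.continuous_val.comp continuous_subtype_val)).subtype_mk _

variable (n) in
/-- `unitaryEquivSp`, as a homeomorphism. -/
noncomputable def unitaryHomeomorphSp : unitary (FormAlgebra (spForm n)) ≃ₜ Sp n where
  toEquiv := (unitaryEquivSp n).toEquiv
  continuous_toFun := continuous_unitaryEquivSp
  continuous_invFun := continuous_unitaryEquivSp_symm

instance : T2Space (PSp n) := by
  have : T2Space (Sp n) := (unitaryHomeomorphSp n).t2Space
  have hclosed : IsClosed (pmOne n : Set (Sp n)) :=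
    (Set.toFinite {1, (⟨-1, neg_one_mem_Sp n⟩ : Sp n)}).isClosed
  infer_instance

variable (n) in
/-- The covering of `PSp n` by the isometry group of `spForm n`. -/
noncomputable def unitaryToPSp : unitary (FormAlgebra (spForm n)) →* PSp n :=
  (QuotientGroup.mk' (pmOne n)).comp (unitaryEquivSp n)

theorem isOpenQuotientMap_unitaryToPSp : IsOpenQuotientMap (unitaryToPSp n) :=
  QuotientGroup.isOpenQuotientMap_mk.comp (unitaryHomeomorphSp n).isOpenQuotientMap

theorem eq_one_or_eq_neg_one_of_mem_ker {u : unitary (FormAlgebra (spForm n))}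
    (hu : u ∈ (unitaryToPSp n).ker) :
    (u : FormAlgebra (spForm n)) = 1 ∨ (u : FormAlgebra (spForm n)) = -1 :=
  ((QuotientGroup.eq_one_iff _).1 hu).imp (congrArg fun A : Sp n => A.1.val)
    (congrArg fun A : Sp n => A.1.val)

end Sp

end QuatHyp

theorem theorem1p1_general {ι : Type*} [Fintype ι] [DecidableEq ι] [Nontrivial ι]
    (J : QuatHyp.NondegenerateHermitian ι) {G : Type*} [Group G] [TopologicalSpace G]
    [IsTopologicalGroup G] [T2Space G] [MeasurableSpace (G × G)] [BorelSpace (G × G)]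
    (μ : MeasureTheory.Measure (G × G)) [μ.IsHaarMeasure]
    {π : unitary (QuatHyp.FormAlgebra J) →* G} (hπ : IsOpenQuotientMap π)
    (hker : ∀ u ∈ π.ker, (u : QuatHyp.FormAlgebra J) = 1 ∨ (u : QuatHyp.FormAlgebra J) = -1) :
    μ {p : G × G | QuatHyp.StronglyDoublyReversible p.1 p.2} = 0 := by
  have hfinite : (π.ker : Set (unitary (QuatHyp.FormAlgebra J))).Finite :=
    (Set.toFinite {1, -1}).subset fun u hu => (hker u hu).imp Subtype.ext Subtype.ext
  refine QuatHyp.measure_stronglyDoublyReversible_eq_zero μ hπ hfinite.countable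
    (fun h hh => QuatHyp.FormAlgebra.finrank_skewAnticommutant_le h.2 (hker _ hh)) ?_
  rw [QuatHyp.FormAlgebra.finrank_skewAdjoint]
  nlinarith [Fintype.one_lt_card (α := ι)]

theorem theorem1p1 (n : ℕ) (hn : 1 ≤ n)
    [MeasurableSpace (QuatHyp.PSp n × QuatHyp.PSp n)] [BorelSpace (QuatHyp.PSp n × QuatHyp.PSp n)]
    (μ : MeasureTheory.Measure (QuatHyp.PSp n × QuatHyp.PSp n)) [μ.IsHaarMeasure] :
    μ {p : QuatHyp.PSp n × QuatHyp.PSp n | QuatHyp.StronglyDoublyReversible p.1 p.2} = 0 := by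
  have : Nontrivial (Fin (n + 1)) := Fin.nontrivial_iff_two_le.2 (Nat.succ_le_succ hn)
  exact theorem1p1_general (QuatHyp.spForm n) μ QuatHyp.isOpenQuotientMap_unitaryToPSp
    fun _ => QuatHyp.eq_one_or_eq_neg_one_of_mem_ker
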